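/- Let $\Omega\subset\mathbb R^n$ be a bounded open set and let $X_i=\sum_{j=1}^n b^{ij}D_j$, $i=1,\dots,m$, be vector fields with coefficients $b^{ij}\in C^\infty(\Omega)$ such that (i) $X_i^*=-X_i$ on $\Omega$ for every $i$, that is, $\int_\Omega (X_i\varphi)\,\psi=-\int_\Omega \varphi\,X_i\psi$ for all $\varphi,\psi\in C_c^\infty(\Omega)$; (iii) $[X_i,[X_i,X_j]]=0$ on $\Omega$ for all $i,j=1,\dots,m$. For $w\in C^2(\Omega)$ let $X^2w=[X_iX_jw]_{i,j=1,\dots,m}$. For a real $m\times m$ matrix $r$ let $F_2(r)=\sum_{i<j}\lambda_i\lambda_j$, where $\lambda_1,\dots,\lambda_m$ are the eigenvalues of $\frac12(r+r^{T})$, let $F_2^{ij}(r)=\partial F_2/\partial r_{ij}(r)$, and let $$\mathscr F_2(r)=\frac12\Big\{\Big(\sum_i r_{ii}\Big)^2-\sum_{i,j}r_{ij}r_{ji}+\frac12\sum_{i,j}(r_{ij}-r_{ji})^2\Big\},\qquad \mathscr F_2[w]=\mathscr F_2(X^2w).$$ Let $u,v\in C^2(\Omega)\cap C^0(\overline\Omega)$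 satisfy $u\le v$ in $\Omega$ and $u=v$ on $\partial\Omega$, and suppose that $F_2$ is degenerate elliptic at $u+v$, that is, $\sum_{i,j}F_2^{ij}(X^2(u+v))\,\xi_i\xi_j\ge 0$ in $\Omega$ for all $\xi\in\mathbb R^m$. Then $$\int_\Omega\mathscr F_2[v]\le\int_\Omega\mathscr F_2[u]$$ whenever both integrals exist in $[-\infty,\infty]$ (in particular, as an inequality of real numbers, if both integrands are integrable on $\Omega$). Moreover, without any integrability assumption, $\int_\Omega(\mathscr F_2[v]-\mathscr F_2[u])^+\le\int_\Omega(\mathscr F_2[u]-\mathscr F_2[v])^+$ in $[0,\infty]$. -/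

import Mathlib

open MeasureTheory
open scoped ContDiff

noncomputable section

namespace Subelliptic

/-- The derivative `X u` of a function `u` along the vector field `X = ∑ⱼ bʲ Dⱼ`, where the field
is given by its coefficient vector `X x = (b¹ x, …, bⁿ x)`. -/
def along {n : ℕ} (X : EuclideanSpace ℝ (Fin n) → EuclideanSpace ℝ (Fin n))
    (u : EuclideanSpace ℝ (Fin n) → ℝ) (x : EuclideanSpace ℝ (Fin n)) : ℝ :=
  fderiv ℝ u x (X x)

/-- The full Hessian `X²u = [Xᵢ Xⱼ u]` (in general not symmetric). -/
def hessian {n m : ℕ} (X : Fin m → EuclideanSpace ℝ (Fin n) → EuclideanSpace ℝ (Fin n))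
    (u : EuclideanSpace ℝ (Fin n) → ℝ) (x : EuclideanSpace ℝ (Fin n)) :
    Matrix (Fin m) (Fin m) ℝ :=
  Matrix.of fun i j => along (X i) (along (X j) u) x

/-- `X* = -X` on `Ω`, where `X*` is the formal adjoint of the first order operator `X`. -/
def AntiSelfAdjointOn {n : ℕ} (X : EuclideanSpace ℝ (Fin n) → EuclideanSpace ℝ (Fin n))
    (Ω : Set (EuclideanSpace ℝ (Fin n))) : Prop :=
  ∀ φ ψ : EuclideanSpace ℝ (Fin n) → ℝ,
    ContDiff ℝ ∞ φ → HasCompactSupport φ → tsupport φ ⊆ Ω →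
    ContDiff ℝ ∞ ψ → HasCompactSupport ψ → tsupport ψ ⊆ Ω →
    ∫ x in Ω, along X φ x * ψ x = - ∫ x in Ω, φ x * along X ψ x

/-- The second commutators formed from any two of the fields vanish:
`[Xᵢ, [Xᵢ, Xⱼ]] = 0` on `Ω` for all `i, j`. -/
def SecondCommutatorsVanishOn {n m : ℕ}
    (X : Fin m → EuclideanSpace ℝ (Fin n) → EuclideanSpace ℝ (Fin n))
    (Ω : Set (EuclideanSpace ℝ (Fin n))) : Prop :=
  ∀ i j : Fin m, ∀ x ∈ Ω,
    VectorField.lieBracket ℝ (X i) (VectorField.lieBracket ℝ (X i) (X j)) x = 0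

/-- The second elementary symmetric function `S₂(lam) = ∑_{i < j} lamᵢ lamⱼ`. -/
def S2 {m : ℕ} (lam : Fin m → ℝ) : ℝ :=
  ∑ i : Fin m, ∑ j ∈ Finset.Ioi i, lam i * lam j

/-- The symmetric part `(r + rᵀ) / 2` of a square matrix. -/
def symPart {m : ℕ} (r : Matrix (Fin m) (Fin m) ℝ) : Matrix (Fin m) (Fin m) ℝ :=
  (1 / 2 : ℝ) • (r + r.transpose)

theorem symPart_isHermitian {m : ℕ} (r : Matrix (Fin m) (Fin m) ℝ) :
    (symPart r).IsHermitian := by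
  ext i j
  simp [symPart]
  ring

/-- `F₂(r) = S₂(eigenvalues of the symmetric part of r)`. -/
def F2 {m : ℕ} (r : Matrix (Fin m) (Fin m) ℝ) : ℝ :=
  S2 (symPart_isHermitian r).eigenvalues

/-- `F₂^{ij}(r) = ∂F₂/∂r_{ij}(r)`. -/
def F2coeff {m : ℕ} (r : Matrix (Fin m) (Fin m) ℝ) (i j : Fin m) : ℝ :=
  lineDeriv ℝ F2 r (Matrix.single i j (1 : ℝ))

/-- `F₂` is degenerate elliptic at `w` in `Ω`: the matrix `F₂^{ij}(X²w)` is nonnegative. -/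
def DegenerateEllipticOn {n m : ℕ}
    (X : Fin m → EuclideanSpace ℝ (Fin n) → EuclideanSpace ℝ (Fin n))
    (w : EuclideanSpace ℝ (Fin n) → ℝ) (Ω : Set (EuclideanSpace ℝ (Fin n))) : Prop :=
  ∀ x ∈ Ω, ∀ ξ : Fin m → ℝ,
    0 ≤ ∑ i : Fin m, ∑ j : Fin m, F2coeff (hessian X w x) i j * ξ i * ξ j

/-- `𝓕₂(r) = ½ { (∑ᵢ rᵢᵢ)² - ∑ᵢⱼ rᵢⱼ rⱼᵢ + ½ ∑ᵢⱼ (rᵢⱼ - rⱼᵢ)² }`. -/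
def scrF2 {m : ℕ} (r : Matrix (Fin m) (Fin m) ℝ) : ℝ :=
  (1 / 2 : ℝ) * ((∑ i : Fin m, r i i) ^ 2 - (∑ i : Fin m, ∑ j : Fin m, r i j * r j i)
    + (1 / 2 : ℝ) * ∑ i : Fin m, ∑ j : Fin m, (r i j - r j i) ^ 2)

/-- The operator `𝓕₂[u] = 𝓕₂(X²u)`. -/
def opF2 {n m : ℕ} (X : Fin m → EuclideanSpace ℝ (Fin n) → EuclideanSpace ℝ (Fin n))
    (u : EuclideanSpace ℝ (Fin n) → ℝ) (x : EuclideanSpace ℝ (Fin n)) : ℝ :=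
  scrF2 (hessian X u x)

/-- The integral of `f` over `Ω` exists in `[-∞, ∞]`: the positive part or the negative part of
`f` has finite integral. -/
def HasExtIntegral {n : ℕ} (Ω : Set (EuclideanSpace ℝ (Fin n)))
    (f : EuclideanSpace ℝ (Fin n) → ℝ) : Prop :=
  ∫⁻ x in Ω, ENNReal.ofReal (f x) ≠ ⊤ ∨ ∫⁻ x in Ω, ENNReal.ofReal (-f x) ≠ ⊤

/-- The integral of `f` over `Ω` as an element of `[-∞, ∞]`, namely `∫ f⁺ - ∫ f⁻`
(meaningful if `HasExtIntegral Ω f`). -/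
def extIntegral {n : ℕ} (Ω : Set (EuclideanSpace ℝ (Fin n)))
    (f : EuclideanSpace ℝ (Fin n) → ℝ) : EReal :=
  ((∫⁻ x in Ω, ENNReal.ofReal (f x) : ENNReal) : EReal)
    - ((∫⁻ x in Ω, ENNReal.ofReal (-f x) : ENNReal) : EReal)

end Subelliptic

end

/-!
Write `w = v - u ≥ 0` and `z = u + v`. The function `𝓕₂` is a quadratic form, so polarization gives
`𝓕₂[v] - 𝓕₂[u] = ½ ∑ᵢⱼ Aᵢⱼ Xᵢ Xⱼ w` with `Aᵢⱼ = δᵢⱼ tr Z + Zᵢⱼ - 2 Zⱼᵢ`, `Z = X²z`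
(`scrF2_sub_scrF2`). Two properties of `A` carry the proof.

* The symmetric part of `A` is the matrix `F₂^{ij}(X²z)` (`sum_linCoeff_mul_mul`), which is
  nonnegative by degenerate ellipticity.
* Formally `∑ᵢ Xᵢ Aᵢⱼ = ∑ᵢ (Xⱼ Xᵢ Xᵢ + Xᵢ Xᵢ Xⱼ - 2 Xᵢ Xⱼ Xᵢ) z = ∑ᵢ [Xᵢ, [Xᵢ, Xⱼ]] z = 0`; the
  antisymmetric terms of `𝓕₂` are there for this purpose. As `z` is only `C²`, the identity is
  used in the weak form `integral_fderiv_linCoeff_column`, in which the derivatives fall on a smooth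
  test function; mollification extends it to `C¹` test functions.

Testing with `ζ = θ(w)`, where `θ` is nondecreasing and vanishes near `0`, one gets
`∫ ζ ∑ Aᵢⱼ Xᵢ Xⱼ w = - ∫ θ'(w) ∑ F₂^{ij}(X²z) Xᵢ w Xⱼ w ≤ 0`
(`integral_comp_mul_linCoeff_hessian_nonpos`). The boundary condition makes `ζ` compactly supported.
Letting `θ` increase to the indicator function of `(0, ∞)` yields the inequality on `{w > 0}`; on
`{w = 0}` the integrand is zero almost everywhere (`ae_hessian_eq_zero`). This is the inequality for
the difference of the integrands, from which the other two follow.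
-/

noncomputable section

namespace Subelliptic

/-! ### The quadratic forms `F₂` and `𝓕₂` -/

theorem sum_eigenvalues_sq {m : ℕ} {A : Matrix (Fin m) (Fin m) ℝ} (hA : A.IsHermitian) :
    ∑ i, hA.eigenvalues i ^ 2 = (A * A).trace := by
  conv_rhs => rw [hA.spectral_theorem, ← map_mul, Unitary.conjStarAlgAut_apply,
    Matrix.trace_mul_comm, ← mul_assoc]
  simp [Matrix.diagonal_mul_diagonal, Matrix.trace_diagonal, sq]

theorem two_mul_S2 {m : ℕ} (lam : Fin m → ℝ) :
    2 * S2 lam = (∑ i, lam i) ^ 2 - ∑ i, lam i ^ 2 := by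
  have h : ∑ i, ∑ j ∈ Finset.Ioi i, lam i * lam j = ∑ i, ∑ j ∈ Finset.Iio i, lam i * lam j := by
    rw [Finset.sum_comm' (t' := Finset.univ) (s' := fun j => Finset.Iio j) (by simp)]
    simp only [mul_comm]
  have h2 : ∀ i, ∑ j, lam i * lam j = ∑ j ∈ Finset.Ioi i, lam i * lam j
      + ∑ j ∈ Finset.Iio i, lam i * lam j + lam i ^ 2 := by
    intro i
    rw [← Finset.sum_filter_add_sum_filter_not Finset.univ (fun j => i < j),
      ← Finset.sum_filter_add_sum_filter_not (Finset.univ.filter fun j => ¬ i < j)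
        (fun j => j < i), Finset.filter_filter, Finset.filter_filter]
    have e1 : Finset.univ.filter (fun j => i < j) = Finset.Ioi i := by ext; simp
    have e2 : Finset.univ.filter (fun j => ¬ i < j ∧ j < i) = Finset.Iio i := by
      ext; simp; exact le_of_lt
    have e3 : Finset.univ.filter (fun j => ¬ i < j ∧ ¬ j < i) = {i} := by
      ext; simp [le_antisymm_iff]
    rw [e1, e2, e3, Finset.sum_singleton]
    ring
  rw [sq, Finset.sum_mul_sum, Finset.sum_congr rfl fun i _ => h2 i]
  simp only [Finset.sum_add_distrib, ← h, S2]
  ring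

theorem F2_eq {m : ℕ} (r : Matrix (Fin m) (Fin m) ℝ) :
    F2 r = 1 / 2 * (r.trace ^ 2 - ∑ i, ∑ j, symPart r i j * symPart r j i) := by
  have h := two_mul_S2 (symPart_isHermitian r).eigenvalues
  have htr := (symPart_isHermitian r).trace_eq_sum_eigenvalues
  have ht : (symPart r).trace = r.trace := by
    simp [symPart, Matrix.trace_add]; ring
  rw [sum_eigenvalues_sq, show ∑ i, (symPart_isHermitian r).eigenvalues i = r.trace by
    rw [← ht, htr]; simp] at h
  simp only [Matrix.trace, Matrix.mul_apply, Matrix.diag_apply] at h ⊢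
  rw [F2]
  linarith

theorem F2coeff_eq {m : ℕ} (r : Matrix (Fin m) (Fin m) ℝ) (i j : Fin m) :
    F2coeff r i j = (if i = j then r.trace else 0) - symPart r i j := by
  set e := Matrix.single i j (1 : ℝ) with he
  have hs : ∀ t : ℝ, symPart (r + t • e) = symPart r + t • symPart e := by
    intro t; ext a b; simp [symPart]; ring
  -- `F₂` is a quadratic form, so its restriction to a line is a polynomial.
  have hpoly : ∀ t : ℝ, F2 (r + t • e) = F2 r
      + t * (r.trace * e.trace - ∑ a, ∑ b, symPart r a b * symPart e b a)
      + t ^ 2 * F2 e := by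
    intro t
    rw [F2_eq, F2_eq r, F2_eq e, hs]
    have hsw : ∑ a, ∑ b, symPart e a b * symPart r b a
        = ∑ a, ∑ b, symPart r a b * symPart e b a := by
      rw [Finset.sum_comm]; simp only [mul_comm]
    have : ∑ a, ∑ b, (symPart r + t • symPart e) a b * (symPart r + t • symPart e) b a
        = ∑ a, ∑ b, symPart r a b * symPart r b a
          + t * ∑ a, ∑ b, symPart r a b * symPart e b a
          + t * ∑ a, ∑ b, symPart e a b * symPart r b a
          + t ^ 2 * ∑ a, ∑ b, symPart e a b * symPart e b a := by
      simp only [Finset.mul_sum, ← Finset.sum_add_distrib]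
      refine Finset.sum_congr rfl fun a _ => Finset.sum_congr rfl fun b _ => ?_
      simp only [Matrix.add_apply, Matrix.smul_apply, smul_eq_mul]
      ring
    rw [this, hsw, Matrix.trace_add, Matrix.trace_smul, smul_eq_mul]
    ring
  have hd : HasDerivAt (fun t : ℝ => F2 (r + t • e))
      (r.trace * e.trace - ∑ a, ∑ b, symPart r a b * symPart e b a) 0 := by
    rw [funext hpoly]
    have := (((hasDerivAt_id (0 : ℝ)).mul_const
      (r.trace * e.trace - ∑ a, ∑ b, symPart r a b * symPart e b a)).const_add (F2 r)).add
      (((hasDerivAt_id (0 : ℝ)).pow 2).mul_const (F2 e))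
    refine HasDerivAt.congr_deriv this ?_
    simp
  rw [F2coeff, lineDeriv, ← he, hd.deriv]
  have hsym : ∀ a b, symPart r a b = symPart r b a := by
    intro a b; simp [symPart, add_comm]
  have h1 : ∑ a, ∑ b, symPart r a b * symPart e b a = ∑ a, ∑ b, symPart r a b * e a b := by
    have h2 : ∑ a, ∑ b, symPart r a b * e b a = ∑ a, ∑ b, symPart r a b * e a b := by
      rw [Finset.sum_comm]
      exact Finset.sum_congr rfl fun a _ => Finset.sum_congr rfl fun b _ => by rw [hsym]
    have : ∀ a b, symPart r a b * symPart e b a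
        = 1 / 2 * (symPart r a b * e b a) + 1 / 2 * (symPart r a b * e a b) := by
      intro a b
      have : symPart e b a = 1 / 2 * (e b a + e a b) := by simp [symPart]
      rw [this]; ring
    simp only [this, Finset.sum_add_distrib, ← Finset.mul_sum, h2]
    ring
  rw [h1]
  congr 1
  · rw [he]
    split_ifs with h
    · subst h; simp
    · simp [h]
  · simp only [he, Matrix.single_apply]
    rw [Finset.sum_eq_single i, Finset.sum_eq_single j] <;> simp +contextual [eq_comm]

/-- The gradient `∂𝓕₂/∂rᵢⱼ` of the quadratic form `𝓕₂` at `r`, i.e. the matrix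
`Aᵢⱼ(r) = δᵢⱼ tr r + rᵢⱼ - 2 rⱼᵢ`, whose symmetric part is the matrix `F₂^{ij}(r)`. -/
def linCoeff {m : ℕ} (r : Matrix (Fin m) (Fin m) ℝ) (i j : Fin m) : ℝ :=
  (if i = j then r.trace else 0) + r i j - 2 * r j i

theorem sum_linCoeff_mul_mul {m : ℕ} (r : Matrix (Fin m) (Fin m) ℝ) (ξ : Fin m → ℝ) :
    ∑ i, ∑ j, linCoeff r i j * ξ i * ξ j = ∑ i, ∑ j, F2coeff r i j * ξ i * ξ j := by
  have hsw : ∑ i, ∑ j, r j i * ξ i * ξ j = ∑ i, ∑ j, r i j * ξ i * ξ j := by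
    rw [Finset.sum_comm]
    exact Finset.sum_congr rfl fun a _ => Finset.sum_congr rfl fun b _ => by ring
  have h1 : ∀ i j, linCoeff r i j * ξ i * ξ j = (if i = j then r.trace else 0) * ξ i * ξ j
      + (r i j * ξ i * ξ j - 2 * (r j i * ξ i * ξ j)) := by
    intro i j; rw [linCoeff]; ring
  have h2 : ∀ i j, F2coeff r i j * ξ i * ξ j = (if i = j then r.trace else 0) * ξ i * ξ j
      - (1 / 2 * (r i j * ξ i * ξ j) + 1 / 2 * (r j i * ξ i * ξ j)) := by
    intro i j
    have : symPart r i j = 1 / 2 * (r i j + r j i) := by simp [symPart]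
    rw [F2coeff_eq, this]; ring
  simp only [h1, h2, Finset.sum_add_distrib, Finset.sum_sub_distrib, ← Finset.mul_sum, hsw]
  ring

/-- Polarization of the quadratic form `𝓕₂`. -/
theorem scrF2_sub_scrF2 {m : ℕ} (a b : Matrix (Fin m) (Fin m) ℝ) :
    scrF2 b - scrF2 a = 1 / 2 * ∑ i, ∑ j, linCoeff (a + b) i j * (b - a) i j := by
  have hsw : ∀ f : Fin m → Fin m → ℝ, ∑ i, ∑ j, f j i = ∑ i, ∑ j, f i j :=
    fun f => Finset.sum_comm
  have h1 : ∀ i j, linCoeff (a + b) i j * (b - a) i j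
      = (if i = j then (a + b).trace else 0) * (b - a) i j
        + (b i j * b i j - a i j * a i j) - 2 * (b i j * b j i - a i j * a j i)
        + 2 * (a i j * b j i) - 2 * (a j i * b i j) := by
    intro i j; simp only [linCoeff, Matrix.add_apply, Matrix.sub_apply]; ring
  have h2 : ∀ r : Matrix (Fin m) (Fin m) ℝ, ∀ i j, (r i j - r j i) ^ 2
      = r i j * r i j + r j i * r j i - 2 * (r i j * r j i) := fun r i j => by ring
  have h3 : ∑ i, ∑ j, (if i = j then (a + b).trace else 0) * (b - a) i j
      = b.trace ^ 2 - a.trace ^ 2 := by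
    simp only [ite_mul, zero_mul, Finset.sum_ite_eq, Finset.mem_univ, if_true, ← Finset.mul_sum]
    have : ∑ i, (b - a) i i = (b - a).trace := rfl
    rw [this, Matrix.trace_add, Matrix.trace_sub]; ring
  simp only [h1, scrF2, h2, Finset.sum_add_distrib, Finset.sum_sub_distrib, ← Finset.mul_sum, h3,
    hsw (fun i j => a i j * b j i), hsw (fun i j => a i j * a i j),
    hsw (fun i j => b i j * b i j)]
  simp only [Matrix.trace, Matrix.diag_apply]
  ring

/-! ### Test functions and derivatives along vector fields -/

/-- `φ` is a test function of class `C^k` on `Ω`, i.e. `φ ∈ C_c^k(Ω)`, extended by zero to the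
whole space. -/
structure IsTest {n : ℕ} (k : WithTop ℕ∞) (Ω : Set (EuclideanSpace ℝ (Fin n)))
    (φ : EuclideanSpace ℝ (Fin n) → ℝ) : Prop where
  contDiff : ContDiff ℝ k φ
  hasCompactSupport : HasCompactSupport φ
  tsupport_subset : tsupport φ ⊆ Ω

section

variable {n m : ℕ} {Ω : Set (EuclideanSpace ℝ (Fin n))}

theorem IsTest.of_le {k l : WithTop ℕ∞} {φ : EuclideanSpace ℝ (Fin n) → ℝ}
    (h : IsTest k Ω φ) (hl : l ≤ k) : IsTest l Ω φ :=
  ⟨h.contDiff.of_le hl, h.hasCompactSupport, h.tsupport_subset⟩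

/-- A function which is `C^k` on the open set `Ω` and vanishes off a compact subset of `Ω` is
globally `C^k`. -/
theorem IsTest.of_contDiffOn {k : WithTop ℕ∞} {φ : EuclideanSpace ℝ (Fin n) → ℝ}
    {K : Set (EuclideanSpace ℝ (Fin n))} (hΩ : IsOpen Ω) (hφ : ContDiffOn ℝ k φ Ω)
    (hK : IsCompact K) (hKΩ : K ⊆ Ω) (h0 : ∀ x ∉ K, φ x = 0) : IsTest k Ω φ := by
  have hs : tsupport φ ⊆ K :=
    closure_minimal (fun x hx => by_contra fun h => hx (h0 x h)) hK.isClosed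
  refine ⟨contDiff_iff_contDiffAt.2 fun x => ?_, hK.of_isClosed_subset (isClosed_tsupport _) hs,
    hs.trans hKΩ⟩
  by_cases hx : x ∈ Ω
  · exact hφ.contDiffAt (hΩ.mem_nhds hx)
  · have : φ =ᶠ[nhds x] fun _ => 0 :=
      notMem_tsupport_iff_eventuallyEq.1 fun h => hx (hKΩ (hs h))
    exact contDiffAt_const.congr_of_eventuallyEq this

theorem IsTest.mul_contDiffOn {k : WithTop ℕ∞} {φ f : EuclideanSpace ℝ (Fin n) → ℝ}
    (hΩ : IsOpen Ω) (hφ : IsTest k Ω φ) (hf : ContDiffOn ℝ k f Ω) :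
    IsTest k Ω (fun x => φ x * f x) :=
  .of_contDiffOn hΩ (hφ.contDiff.contDiffOn.mul hf) hφ.hasCompactSupport hφ.tsupport_subset
    fun x hx => by simp [image_eq_zero_of_notMem_tsupport hx]

theorem fderiv_eq_zero_of_notMem_tsupport {φ : EuclideanSpace ℝ (Fin n) → ℝ}
    {x : EuclideanSpace ℝ (Fin n)} (hx : x ∉ tsupport φ) : fderiv ℝ φ x = 0 :=
  image_eq_zero_of_notMem_tsupport fun h => hx (tsupport_fderiv_subset ℝ h)

theorem contDiffOn_along {k l : WithTop ℕ∞} (hΩ : IsOpen Ω)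
    {V : EuclideanSpace ℝ (Fin n) → EuclideanSpace ℝ (Fin n)} (hV : ContDiffOn ℝ ∞ V Ω)
    {f : EuclideanSpace ℝ (Fin n) → ℝ} (hf : ContDiffOn ℝ k f Ω) (hl : l + 1 ≤ k)
    (hl' : l ≤ ∞) : ContDiffOn ℝ l (along V f) Ω :=
  (hf.fderiv_of_isOpen hΩ hl).clm_apply (hV.of_le hl')

theorem IsTest.along (hΩ : IsOpen Ω)
    {V : EuclideanSpace ℝ (Fin n) → EuclideanSpace ℝ (Fin n)} (hV : ContDiffOn ℝ ∞ V Ω)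
    {φ : EuclideanSpace ℝ (Fin n) → ℝ} (hφ : IsTest ∞ Ω φ) : IsTest ∞ Ω (along V φ) :=
  .of_contDiffOn hΩ (contDiffOn_along hΩ hV hφ.contDiff.contDiffOn (by simp) le_rfl)
    hφ.hasCompactSupport hφ.tsupport_subset fun x hx => by
      simp [Subelliptic.along, fderiv_eq_zero_of_notMem_tsupport hx]

theorem along_mul {V : EuclideanSpace ℝ (Fin n) → EuclideanSpace ℝ (Fin n)}
    {f g : EuclideanSpace ℝ (Fin n) → ℝ} {x : EuclideanSpace ℝ (Fin n)}
    (hf : DifferentiableAt ℝ f x) (hg : DifferentiableAt ℝ g x) :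
    along V (fun y => f y * g y) x = along V f x * g x + f x * along V g x := by
  simp only [along, fderiv_fun_mul hf hg, add_apply, smul_apply, smul_eq_mul]
  ring

theorem along_congr {V : EuclideanSpace ℝ (Fin n) → EuclideanSpace ℝ (Fin n)}
    {f g : EuclideanSpace ℝ (Fin n) → ℝ} {x : EuclideanSpace ℝ (Fin n)} (hΩ : IsOpen Ω)
    (hx : x ∈ Ω) (h : ∀ y ∈ Ω, f y = g y) : along V f x = along V g x := by
  have : f =ᶠ[nhds x] g := Filter.eventuallyEq_of_mem (hΩ.mem_nhds hx) h
  rw [along, along, this.fderiv_eq]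

/-- A function continuous on `Ω` and vanishing off a compact subset of `Ω` is integrable. -/
theorem integrable_of_continuousOn {f : EuclideanSpace ℝ (Fin n) → ℝ}
    {K : Set (EuclideanSpace ℝ (Fin n))} (hf : ContinuousOn f Ω)
    (hK : IsCompact K) (hKΩ : K ⊆ Ω) (h0 : ∀ x ∉ K, f x = 0) : Integrable f :=
  (integrableOn_iff_integrable_of_support_subset
    fun x hx => by_contra fun h => hx (h0 x h)).1 ((hf.mono hKΩ).integrableOn_compact hK)

/-- The sets `{w ≥ ε}`, `ε > 0`, of a function `w` which is continuous up to the boundary and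
vanishes there are compact subsets of `Ω`, so functions of `w` vanishing near `w = 0` are test
functions. -/
theorem isTest_indicator_smoothTransition (hΩ : IsOpen Ω) (hΩb : Bornology.IsBounded Ω)
    {k : ℕ∞} {w : EuclideanSpace ℝ (Fin n) → ℝ} (hw : ContDiffOn ℝ k w Ω)
    (hwc : ContinuousOn w (closure Ω)) (hw0 : ∀ x ∈ frontier Ω, w x = 0) (c : ℝ) :
    IsTest k Ω (Ω.indicator fun x => Real.smoothTransition (c * w x - 1)) := by
  have hcl : IsClosed (closure Ω ∩ (fun x => c * w x - 1) ⁻¹' Set.Ici 0) :=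
    ((continuousOn_const.mul hwc).sub continuousOn_const).preimage_isClosed_of_isClosed
      isClosed_closure isClosed_Ici
  refine .of_contDiffOn (K := closure Ω ∩ (fun x => c * w x - 1) ⁻¹' Set.Ici 0) hΩ ?_
    (hΩb.isCompact_closure.of_isClosed_subset hcl Set.inter_subset_left) ?_ fun x hx => ?_
  · refine ContDiffOn.congr (Real.smoothTransition.contDiff.comp_contDiffOn
      ((contDiffOn_const (c := c)).mul hw |>.sub (contDiffOn_const (c := (1 : ℝ))))) fun x hx => ?_
    simp [hx]
  · rintro x ⟨hx, hx'⟩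
    by_contra hxΩ
    have := hw0 x (by rw [hΩ.frontier_eq]; exact ⟨hx, hxΩ⟩)
    simp only [Set.mem_preimage, this, Set.mem_Ici] at hx'
    linarith
  · by_cases hxΩ : x ∈ Ω
    · rw [Set.indicator_of_mem hxΩ]
      exact Real.smoothTransition.zero_of_nonpos
        (le_of_not_gt fun h => hx ⟨subset_closure hxΩ, h.le⟩)
    · exact Set.indicator_of_notMem hxΩ _

/-! ### Mollification and integration by parts -/

/-- `C_c^1` test functions are limits of `C_c^∞` test functions, in the sense that the gradients
converge uniformly and the supports stay in a fixed compact set. -/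
theorem IsTest.exists_smooth_approx (hΩ : IsOpen Ω) {φ : EuclideanSpace ℝ (Fin n) → ℝ}
    (hφ : IsTest 1 Ω φ) :
    ∃ K, IsCompact K ∧ K ⊆ Ω ∧ tsupport φ ⊆ K ∧ ∀ ε > 0, ∃ ψ, IsTest ∞ Ω ψ ∧ tsupport ψ ⊆ K ∧
      ∀ x, ‖fderiv ℝ ψ x - fderiv ℝ φ x‖ ≤ ε := by
  obtain ⟨δ, hδ, hδΩ⟩ := hφ.hasCompactSupport.isCompact.exists_cthickening_subset_open hΩ
    hφ.tsupport_subset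
  have hKc : IsCompact (Metric.cthickening δ (tsupport φ)) :=
    hφ.hasCompactSupport.isCompact.cthickening
  refine ⟨_, hKc, hδΩ, Metric.self_subset_cthickening _, fun ε hε => ?_⟩
  have hcont : Continuous (fderiv ℝ φ) := hφ.contDiff.continuous_fderiv one_ne_zero
  have huc : UniformContinuous (fderiv ℝ φ) :=
    (hφ.hasCompactSupport.fderiv ℝ).uniformContinuous_of_continuous hcont
  obtain ⟨r, hr, hr'⟩ := Metric.uniformContinuous_iff.1 huc ε hε
  have hρ : 0 < min δ r := lt_min hδ hr
  let b : ContDiffBump (0 : EuclideanSpace ℝ (Fin n)) :=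
    ⟨min δ r / 2, min δ r, by linarith, by linarith⟩
  let ψ := convolution (b.normed volume) φ (ContinuousLinearMap.lsmul ℝ ℝ) volume
  have hbi : LocallyIntegrable (b.normed volume) volume :=
    b.continuous_normed.locallyIntegrable
  have hψs : tsupport ψ ⊆ Metric.cthickening δ (tsupport φ) := by
    refine closure_minimal ((support_convolution_subset_swap _).trans ?_) hKc.isClosed
    rintro _ ⟨x, hx, y, hy, rfl⟩
    rw [b.support_normed_eq, mem_ball_zero_iff] at hy
    refine Metric.mem_cthickening_of_dist_le _ x _ _ (subset_tsupport _ hx) ?_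
    simpa using hy.le.trans (min_le_left _ _)
  have hψc : ContDiff ℝ ∞ ψ := b.hasCompactSupport_normed.contDiff_convolution_left _
    b.contDiff_normed hφ.contDiff.continuous.locallyIntegrable
  refine ⟨ψ, ⟨hψc, hKc.of_isClosed_subset (isClosed_tsupport _) hψs, hψs.trans hδΩ⟩, hψs,
    fun x => ?_⟩
  have hd := (hφ.hasCompactSupport.hasFDerivAt_convolution_right
    (ContinuousLinearMap.lsmul ℝ ℝ) hbi hφ.contDiff x).fderiv
  rw [hd, ← dist_eq_norm]
  have hL : (ContinuousLinearMap.lsmul ℝ ℝ).precompR (EuclideanSpace ℝ (Fin n))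
      = (ContinuousLinearMap.lsmul ℝ ℝ :
        ℝ →L[ℝ] (EuclideanSpace ℝ (Fin n) →L[ℝ] ℝ) →L[ℝ] _) := by
    ext; simp
  rw [hL]
  refine b.dist_normed_convolution_le hcont.aestronglyMeasurable fun y hy => (hr' ?_).le
  exact (Metric.mem_ball.1 hy).trans_le (min_le_right _ _)

/-- A continuous vector field on `Ω` that is divergence free in the sense of distributions also
annihilates the gradients of `C_c^1` test functions. -/
theorem integral_fderiv_eq_zero_of_smooth (hΩ : IsOpen Ω)
    {Y : EuclideanSpace ℝ (Fin n) → EuclideanSpace ℝ (Fin n)} (hY : ContinuousOn Y Ω)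
    (h : ∀ ψ, IsTest ∞ Ω ψ → ∫ x in Ω, fderiv ℝ ψ x (Y x) = 0)
    {φ : EuclideanSpace ℝ (Fin n) → ℝ} (hφ : IsTest 1 Ω φ) :
    ∫ x in Ω, fderiv ℝ φ x (Y x) = 0 := by
  obtain ⟨K, hK, hKΩ, hφK, happ⟩ := hφ.exists_smooth_approx hΩ
  have hint : ∀ ψ, IsTest 1 Ω ψ → Integrable fun x => fderiv ℝ ψ x (Y x) := fun ψ hψ =>
    integrable_of_continuousOn
      (((hψ.contDiff.continuous_fderiv one_ne_zero).continuousOn).clm_apply hY)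
      hψ.hasCompactSupport hψ.tsupport_subset
      fun x hx => by simp [fderiv_eq_zero_of_notMem_tsupport hx]
  obtain ⟨C, hC⟩ := hK.exists_bound_of_continuousOn (hY.mono hKΩ)
  rw [← norm_eq_zero]
  refine le_antisymm (le_of_forall_pos_le_add fun ε hε => ?_) (norm_nonneg _)
  have hM : 0 < |C| * volume.real K + 1 := by positivity
  obtain ⟨ψ, hψ, hψK, hψd⟩ := happ (ε / (|C| * volume.real K + 1)) (by positivity)
  set δ := ε / (|C| * volume.real K + 1) with hδ
  have hδ0 : 0 ≤ δ := by positivity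
  have hψ1 := hψ.of_le (l := 1) (by simp)
  have h1 : ∫ x in Ω, fderiv ℝ φ x (Y x)
      = ∫ x in K, (fderiv ℝ φ x (Y x) - fderiv ℝ ψ x (Y x)) := by
    have hset : ∀ ψ, tsupport ψ ⊆ K →
        ∫ x in Ω, fderiv ℝ ψ x (Y x) = ∫ x in K, fderiv ℝ ψ x (Y x) := fun ψ hψK =>
      setIntegral_eq_of_subset_of_forall_sdiff_eq_zero hΩ.measurableSet hKΩ fun x hx => by
        rw [fderiv_eq_zero_of_notMem_tsupport fun h => hx.2 (hψK h)]; rfl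
    rw [integral_sub (hint φ hφ).integrableOn (hint ψ hψ1).integrableOn, ← hset φ hφK,
      ← hset ψ hψK, h ψ hψ, sub_zero]
  rw [h1]
  have h2 : ‖∫ x in K, (fderiv ℝ φ x (Y x) - fderiv ℝ ψ x (Y x))‖
      ≤ δ * |C| * volume.real K := by
    refine norm_setIntegral_le_of_norm_le_const hK.measure_lt_top fun x hx => ?_
    rw [← sub_apply]
    refine (ContinuousLinearMap.le_opNorm _ _).trans ?_
    rw [norm_sub_rev]
    exact mul_le_mul (hψd x) ((hC x hx).trans (le_abs_self C)) (norm_nonneg _) hδ0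
  have h3 : δ * (|C| * volume.real K + 1) = ε := by rw [hδ]; field_simp
  nlinarith

/-- A smooth function that is equal to `1` near a compact subset of `Ω`. -/
theorem exists_cutoff (hΩ : IsOpen Ω) {K : Set (EuclideanSpace ℝ (Fin n))} (hK : IsCompact K)
    (hKΩ : K ⊆ Ω) : ∃ χ, IsTest ∞ Ω χ ∧ (∀ x ∈ K, χ =ᶠ[nhds x] fun _ => 1) := by
  obtain ⟨L, hL, hKL, hLΩ⟩ := exists_compact_between hK hΩ hKΩ
  obtain ⟨f, hf1, hf0, -⟩ := exists_contMDiffMap_one_nhds_of_subset_interior (n := (⊤ : ℕ∞))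
    (modelWithCornersSelf ℝ (EuclideanSpace ℝ (Fin n))) hK.isClosed hKL
  exact ⟨f, .of_contDiffOn hΩ f.contMDiff.contDiff.contDiffOn hL hLΩ hf0,
    fun x hx => hf1.filter_mono (nhds_le_nhdsSet hx)⟩

/-- Anti-self-adjoint fields are divergence free; the second test function is a cutoff equal to `1`
near the support of the first. -/
theorem AntiSelfAdjointOn.integral_along_eq_zero (hΩ : IsOpen Ω)
    {V : EuclideanSpace ℝ (Fin n) → EuclideanSpace ℝ (Fin n)} (hVc : ContinuousOn V Ω)
    (hV : AntiSelfAdjointOn V Ω) {φ : EuclideanSpace ℝ (Fin n) → ℝ} (hφ : IsTest 1 Ω φ) :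
    ∫ x in Ω, along V φ x = 0 := by
  refine integral_fderiv_eq_zero_of_smooth hΩ hVc (fun ψ hψ => ?_) hφ
  obtain ⟨χ, hχ, hχ1⟩ := exists_cutoff hΩ hψ.hasCompactSupport hψ.tsupport_subset
  have key := hV ψ χ hψ.contDiff hψ.hasCompactSupport hψ.tsupport_subset
    hχ.contDiff hχ.hasCompactSupport hχ.tsupport_subset
  have e1 : ∀ x, along V ψ x * χ x = fderiv ℝ ψ x (V x) := by
    intro x
    by_cases hx : x ∈ tsupport ψ
    · simp [along, (hχ1 x hx).self_of_nhds]
    · simp [along, fderiv_eq_zero_of_notMem_tsupport hx]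
  have e2 : ∀ x, ψ x * along V χ x = 0 := by
    intro x
    by_cases hx : x ∈ tsupport ψ
    · simp [along, (hχ1 x hx).fderiv_eq]
    · simp [image_eq_zero_of_notMem_tsupport hx]
  simpa [e1, e2] using key

/-- Integration by parts along an anti-self-adjoint field. -/
theorem AntiSelfAdjointOn.integral_along_mul (hΩ : IsOpen Ω)
    {V : EuclideanSpace ℝ (Fin n) → EuclideanSpace ℝ (Fin n)} (hVc : ContinuousOn V Ω)
    (hV : AntiSelfAdjointOn V Ω) {f φ : EuclideanSpace ℝ (Fin n) → ℝ} (hf : ContDiffOn ℝ 1 f Ω)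
    (hφ : IsTest 1 Ω φ) :
    ∫ x in Ω, along V f x * φ x = - ∫ x in Ω, f x * along V φ x := by
  have h := hV.integral_along_eq_zero hΩ hVc (hφ.mul_contDiffOn hΩ hf)
  have hfd : ContinuousOn (fderiv ℝ f) Ω := hf.continuousOn_fderiv_of_isOpen hΩ le_rfl
  have hi1 : Integrable fun x => along V f x * φ x :=
    integrable_of_continuousOn ((hfd.clm_apply hVc).mul hφ.contDiff.continuous.continuousOn)
      hφ.hasCompactSupport hφ.tsupport_subset
      fun x hx => by simp [image_eq_zero_of_notMem_tsupport hx]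
  have hi2 : Integrable fun x => f x * along V φ x :=
    integrable_of_continuousOn (hf.continuousOn.mul
      ((hφ.contDiff.continuous_fderiv one_ne_zero).continuousOn.clm_apply hVc))
      hφ.hasCompactSupport hφ.tsupport_subset
      fun x hx => by simp [along, fderiv_eq_zero_of_notMem_tsupport hx]
  rw [eq_neg_iff_add_eq_zero, ← integral_add hi1.integrableOn hi2.integrableOn, ← h]
  refine setIntegral_congr_fun hΩ.measurableSet fun x hx => ?_
  rw [along_mul (hφ.contDiff.differentiable one_ne_zero x)
    ((hf.contDiffAt (hΩ.mem_nhds hx)).differentiableAt one_ne_zero)]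
  ring

/-! ### Commutators and the divergence structure -/

theorem along_lieBracket (hΩ : IsOpen Ω)
    {V W : EuclideanSpace ℝ (Fin n) → EuclideanSpace ℝ (Fin n)} (hV : ContDiffOn ℝ ∞ V Ω)
    (hW : ContDiffOn ℝ ∞ W Ω) {f : EuclideanSpace ℝ (Fin n) → ℝ} (hf : ContDiffOn ℝ 2 f Ω)
    {x : EuclideanSpace ℝ (Fin n)} (hx : x ∈ Ω) :
    along (VectorField.lieBracket ℝ V W) f x
      = along V (along W f) x - along W (along V f) x :=
  VectorField.fderiv_apply_lieBracket (hf.contDiffAt (hΩ.mem_nhds hx)) (by simp)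
    ((hW.contDiffAt (hΩ.mem_nhds hx)).differentiableAt (by simp))
    ((hV.contDiffAt (hΩ.mem_nhds hx)).differentiableAt (by simp))

/-- `[V, [V, W]] = V V W + W V V - 2 V W V`. -/
theorem along_second_commutator (hΩ : IsOpen Ω)
    {V W : EuclideanSpace ℝ (Fin n) → EuclideanSpace ℝ (Fin n)} (hV : ContDiffOn ℝ ∞ V Ω)
    (hW : ContDiffOn ℝ ∞ W Ω) {f : EuclideanSpace ℝ (Fin n) → ℝ} (hf : ContDiffOn ℝ ∞ f Ω)
    {x : EuclideanSpace ℝ (Fin n)} (hx : x ∈ Ω) :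
    along (VectorField.lieBracket ℝ V (VectorField.lieBracket ℝ V W)) f x
      = along V (along V (along W f)) x + along W (along V (along V f)) x
        - 2 * along V (along W (along V f)) x := by
  have hB : ContDiffOn ℝ ∞ (VectorField.lieBracket ℝ V W) Ω := fun y hy =>
    ((hV.contDiffAt (hΩ.mem_nhds hy)).lieBracket_vectorField
      (hW.contDiffAt (hΩ.mem_nhds hy)) (by simp)).contDiffWithinAt
  have hal : ∀ {U g}, ContDiffOn ℝ ∞ U Ω → ContDiffOn ℝ ∞ g Ω → ContDiffOn ℝ ∞ (along U g) Ω :=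
    fun hU hg => contDiffOn_along hΩ hU hg (by simp) le_rfl
  have h2 : ∀ {g : EuclideanSpace ℝ (Fin n) → ℝ}, ContDiffOn ℝ ∞ g Ω → ContDiffOn ℝ 2 g Ω :=
    fun hg => hg.of_le (WithTop.coe_le_coe.2 (le_top : (2 : ℕ∞) ≤ ⊤))
  have hd : ∀ {g : EuclideanSpace ℝ (Fin n) → ℝ}, ContDiffOn ℝ ∞ g Ω → DifferentiableAt ℝ g x :=
    fun hg => (hg.contDiffAt (hΩ.mem_nhds hx)).differentiableAt (by simp)
  rw [along_lieBracket hΩ hV hB (h2 hf) hx, along_lieBracket hΩ hV hW (h2 (hal hV hf)) hx,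
    along_congr hΩ hx fun y hy => along_lieBracket hΩ hV hW (h2 hf) hy]
  have : along V (fun y => along V (along W f) y - along W (along V f) y) x
      = along V (along V (along W f)) x - along V (along W (along V f)) x := by
    simp only [along.eq_1 V (fun y => _ - _),
      fderiv_fun_sub (hd (hal hV (hal hW hf))) (hd (hal hW (hal hV hf))), sub_apply]
    rfl
  rw [this]
  ring

theorem continuousOn_hessian (hΩ : IsOpen Ω)
    {X : Fin m → EuclideanSpace ℝ (Fin n) → EuclideanSpace ℝ (Fin n)}
    (hX : ∀ i, ContDiffOn ℝ ∞ (X i) Ω) {f : EuclideanSpace ℝ (Fin n) → ℝ}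
    (hf : ContDiffOn ℝ 2 f Ω) (i j : Fin m) : ContinuousOn (fun x => hessian X f x i j) Ω :=
  contDiffOn_zero.1 (contDiffOn_along hΩ (hX i)
    (contDiffOn_along (l := 1) hΩ (hX j) hf (by norm_num) (by exact_mod_cast le_top))
    (l := 0) (by simp) (by simp))

theorem continuousOn_linCoeff {r : EuclideanSpace ℝ (Fin n) → Matrix (Fin m) (Fin m) ℝ}
    (hr : ∀ i j, ContinuousOn (fun x => r x i j) Ω) (i j : Fin m) :
    ContinuousOn (fun x => linCoeff (r x) i j) Ω := by
  have htr : ContinuousOn (fun x => (r x).trace) Ω :=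
    continuousOn_finsetSum _ fun i _ => hr i i
  have hif : ContinuousOn (fun x => if i = j then (r x).trace else 0) Ω := by
    split_ifs
    exacts [htr, continuousOn_const]
  exact (hif.add (hr i j)).sub (continuousOn_const.mul (hr j i))

theorem AntiSelfAdjointOn.integral_along_along_mul (hΩ : IsOpen Ω)
    {V W : EuclideanSpace ℝ (Fin n) → EuclideanSpace ℝ (Fin n)} (hVc : ContDiffOn ℝ ∞ V Ω)
    (hV : AntiSelfAdjointOn V Ω) (hWc : ContDiffOn ℝ ∞ W Ω) (hW : AntiSelfAdjointOn W Ω)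
    {f φ : EuclideanSpace ℝ (Fin n) → ℝ} (hf : ContDiffOn ℝ 2 f Ω) (hφ : IsTest ∞ Ω φ) :
    ∫ x in Ω, along V (along W f) x * φ x = ∫ x in Ω, f x * along W (along V φ) x := by
  have h1 : (1 : WithTop ℕ∞) ≤ ∞ := by exact_mod_cast le_top
  rw [hV.integral_along_mul hΩ hVc.continuousOn
      (contDiffOn_along hΩ hWc hf (by norm_num) h1) (hφ.of_le h1),
    hW.integral_along_mul hΩ hWc.continuousOn (hf.of_le (by norm_num))
      ((hφ.along hΩ hVc).of_le h1), neg_neg]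

/-- The columns of the matrix `A(X²z)` are divergence free along the fields: formally
`∑ᵢ Xᵢ Aᵢⱼ(X²z) = ∑ᵢ [Xᵢ, [Xᵢ, Xⱼ]] z = 0`. Since `z` is only `C²`, this is the weak form of that
identity, obtained by moving both derivatives from `z` to the test function. -/
theorem integral_fderiv_linCoeff_column (hΩ : IsOpen Ω)
    {X : Fin m → EuclideanSpace ℝ (Fin n) → EuclideanSpace ℝ (Fin n)}
    (hX : ∀ i, ContDiffOn ℝ ∞ (X i) Ω) (hanti : ∀ i, AntiSelfAdjointOn (X i) Ω)
    (hcomm : SecondCommutatorsVanishOn X Ω) {z : EuclideanSpace ℝ (Fin n) → ℝ}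
    (hz : ContDiffOn ℝ 2 z Ω) (j : Fin m) {φ : EuclideanSpace ℝ (Fin n) → ℝ}
    (hφ : IsTest 1 Ω φ) :
    ∫ x in Ω, fderiv ℝ φ x (∑ i, linCoeff (hessian X z x) i j • X i x) = 0 := by
  have hh := continuousOn_hessian hΩ hX hz
  refine integral_fderiv_eq_zero_of_smooth hΩ (continuousOn_finsetSum _ fun i _ =>
    (continuousOn_linCoeff hh i j).smul (hX i).continuousOn) (fun ψ hψ => ?_) hφ
  have hψ' := fun i => hψ.along hΩ (hX i)
  have hint : ∀ a b c, Integrable fun x => hessian X z x a b * along (X c) ψ x := fun a b c =>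
    integrable_of_continuousOn ((hh a b).mul (hψ' c).contDiff.continuous.continuousOn)
      (hψ' c).hasCompactSupport (hψ' c).tsupport_subset
      fun x hx => by simp [image_eq_zero_of_notMem_tsupport hx]
  have hint' : ∀ a b c, Integrable fun x => z x * along (X a) (along (X b) (along (X c) ψ)) x :=
    fun a b c =>
      have ht := ((hψ' c).along hΩ (hX b)).along hΩ (hX a)
      integrable_of_continuousOn (hz.continuousOn.mul ht.contDiff.continuous.continuousOn)
        ht.hasCompactSupport ht.tsupport_subset
        fun x hx => by simp [image_eq_zero_of_notMem_tsupport hx]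
  have hparts : ∀ a b c, ∫ x in Ω, hessian X z x a b * along (X c) ψ x
      = ∫ x in Ω, z x * along (X b) (along (X a) (along (X c) ψ)) x := fun a b c =>
    (hanti a).integral_along_along_mul hΩ (hX a) (hX b) (hanti b) hz (hψ' c)
  have hexp : ∀ x, fderiv ℝ ψ x (∑ i, linCoeff (hessian X z x) i j • X i x)
      = ∑ i, (hessian X z x i i * along (X j) ψ x + hessian X z x i j * along (X i) ψ x
        - 2 * (hessian X z x j i * along (X i) ψ x)) := by
    intro x
    simp only [map_sum, map_smul, smul_eq_mul, linCoeff]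
    have htr : ∑ i, (if i = j then (hessian X z x).trace else 0) * fderiv ℝ ψ x (X i x)
        = ∑ i, hessian X z x i i * along (X j) ψ x := by
      simp [ite_mul, ← Finset.sum_mul, Matrix.trace, along]
    simp only [Finset.sum_sub_distrib, Finset.sum_add_distrib, add_mul, sub_mul, htr]
    simp only [along, mul_assoc]
  refine (integral_congr_ae (.of_forall hexp)).trans ?_
  refine (integral_finsetSum _ fun i _ => (((hint i i j).add (hint i j i)).sub
    ((hint j i i).const_mul 2)).integrableOn).trans (Finset.sum_eq_zero fun i _ => ?_)
  have hsub : ∀ {f g h : EuclideanSpace ℝ (Fin n) → ℝ}, Integrable f → Integrable g →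
      Integrable h → ∫ x in Ω, (f x + g x - 2 * h x)
        = (∫ x in Ω, f x) + (∫ x in Ω, g x) - 2 * ∫ x in Ω, h x := by
    intro f g h hf hg hh
    rw [← integral_add hf.integrableOn hg.integrableOn, ← integral_const_mul]
    exact integral_sub (hf.add hg).integrableOn (hh.const_mul 2).integrableOn
  refine (hsub (hint i i j) (hint i j i) (hint j i i)).trans ?_
  rw [hparts, hparts, hparts,
    ← hsub (hint' i i j) (hint' j i i) (hint' i j i)]
  refine setIntegral_eq_zero_of_forall_eq_zero fun x hx => ?_
  have h := along_second_commutator hΩ (hX i) (hX j) hψ.contDiff.contDiffOn hx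
  rw [along, hcomm i j x hx, map_zero] at h
  linear_combination -z x * h

theorem hessian_add (hΩ : IsOpen Ω)
    {X : Fin m → EuclideanSpace ℝ (Fin n) → EuclideanSpace ℝ (Fin n)}
    (hX : ∀ i, ContDiffOn ℝ ∞ (X i) Ω) {f g : EuclideanSpace ℝ (Fin n) → ℝ}
    (hf : ContDiffOn ℝ 2 f Ω) (hg : ContDiffOn ℝ 2 g Ω) {x : EuclideanSpace ℝ (Fin n)}
    (hx : x ∈ Ω) : hessian X (fun y => f y + g y) x = hessian X f x + hessian X g x := by
  have hadd : ∀ {V : EuclideanSpace ℝ (Fin n) → EuclideanSpace ℝ (Fin n)}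
      {f g : EuclideanSpace ℝ (Fin n) → ℝ}, ContDiffOn ℝ 1 f Ω → ContDiffOn ℝ 1 g Ω → ∀ y ∈ Ω,
      along V (fun y => f y + g y) y = along V f y + along V g y := by
    intro V f g hf hg y hy
    rw [along, fderiv_fun_add ((hf.contDiffAt (hΩ.mem_nhds hy)).differentiableAt one_ne_zero)
      ((hg.contDiffAt (hΩ.mem_nhds hy)).differentiableAt one_ne_zero)]
    rfl
  have h1 : (1 : WithTop ℕ∞) ≤ ∞ := by exact_mod_cast le_top
  ext i j
  simp only [hessian, Matrix.of_apply, Matrix.add_apply]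
  rw [along_congr hΩ hx (hadd (hf.of_le (by norm_num)) (hg.of_le (by norm_num))),
    hadd (contDiffOn_along hΩ (hX j) hf (by norm_num) h1)
      (contDiffOn_along hΩ (hX j) hg (by norm_num) h1) x hx]

theorem hessian_neg
    (X : Fin m → EuclideanSpace ℝ (Fin n) → EuclideanSpace ℝ (Fin n))
    (f : EuclideanSpace ℝ (Fin n) → ℝ) (x : EuclideanSpace ℝ (Fin n)) :
    hessian X (fun y => -f y) x = -hessian X f x := by
  have hneg : ∀ {V : EuclideanSpace ℝ (Fin n) → EuclideanSpace ℝ (Fin n)}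
      {f : EuclideanSpace ℝ (Fin n) → ℝ}, along V (fun y => -f y) = fun y => -along V f y := by
    intro V f
    ext y
    simp [along, fderiv_fun_neg]
  ext i j
  simp only [hessian, Matrix.of_apply, Matrix.neg_apply, hneg]

theorem continuousOn_opF2 (hΩ : IsOpen Ω)
    {X : Fin m → EuclideanSpace ℝ (Fin n) → EuclideanSpace ℝ (Fin n)}
    (hX : ∀ i, ContDiffOn ℝ ∞ (X i) Ω) {f : EuclideanSpace ℝ (Fin n) → ℝ}
    (hf : ContDiffOn ℝ 2 f Ω) : ContinuousOn (opF2 X f) Ω := by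
  have h := continuousOn_hessian hΩ hX hf
  unfold opF2 scrF2
  fun_prop

/-- The weak form of `∑ᵢⱼ Aᵢⱼ Xᵢ Xⱼ w = ∑ᵢ Xᵢ (∑ⱼ Aᵢⱼ Xⱼ w)`, where `A = A(X²z)`. -/
theorem integral_mul_linCoeff_hessian (hΩ : IsOpen Ω)
    {X : Fin m → EuclideanSpace ℝ (Fin n) → EuclideanSpace ℝ (Fin n)}
    (hX : ∀ i, ContDiffOn ℝ ∞ (X i) Ω) (hanti : ∀ i, AntiSelfAdjointOn (X i) Ω)
    (hcomm : SecondCommutatorsVanishOn X Ω) {z w : EuclideanSpace ℝ (Fin n) → ℝ}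
    (hz : ContDiffOn ℝ 2 z Ω) (hw : ContDiffOn ℝ 2 w Ω) {ζ : EuclideanSpace ℝ (Fin n) → ℝ}
    (hζ : IsTest 1 Ω ζ) :
    ∫ x in Ω, ζ x * ∑ i, ∑ j, linCoeff (hessian X z x) i j * hessian X w x i j
      = - ∫ x in Ω, ∑ i, ∑ j, linCoeff (hessian X z x) i j * along (X i) ζ x * along (X j) w x := by
  have hA := continuousOn_linCoeff (continuousOn_hessian hΩ hX hz)
  have hH := continuousOn_hessian hΩ hX hw
  have hXw : ∀ j, ContDiffOn ℝ 1 (along (X j) w) Ω := fun j =>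
    contDiffOn_along hΩ (hX j) hw (by norm_num) (by exact_mod_cast le_top)
  have hXζ : ∀ i, ContinuousOn (along (X i) ζ) Ω := fun i =>
    (hζ.contDiff.continuous_fderiv one_ne_zero).continuousOn.clm_apply (hX i).continuousOn
  have hφ : ∀ j, IsTest 1 Ω (fun x => ζ x * along (X j) w x) := fun j =>
    hζ.mul_contDiffOn hΩ (hXw j)
  have hi1 : Integrable fun x =>
      ζ x * ∑ i, ∑ j, linCoeff (hessian X z x) i j * hessian X w x i j :=
    integrable_of_continuousOn (hζ.contDiff.continuous.continuousOn.mul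
      (continuousOn_finsetSum _ fun i _ => continuousOn_finsetSum _ fun j _ =>
        (hA i j).mul (hH i j))) hζ.hasCompactSupport hζ.tsupport_subset
      fun x hx => by simp [image_eq_zero_of_notMem_tsupport hx]
  have hi2 : Integrable fun x =>
      ∑ i, ∑ j, linCoeff (hessian X z x) i j * along (X i) ζ x * along (X j) w x :=
    integrable_of_continuousOn
      (continuousOn_finsetSum _ fun i _ => continuousOn_finsetSum _ fun j _ =>
        ((hA i j).mul (hXζ i)).mul (hXw j).continuousOn) hζ.hasCompactSupport hζ.tsupport_subset
      fun x hx => by simp [along.eq_1 _ ζ, fderiv_eq_zero_of_notMem_tsupport hx]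
  have hi3 : ∀ j, Integrable fun x => fderiv ℝ (fun y => ζ y * along (X j) w y) x
      (∑ i, linCoeff (hessian X z x) i j • X i x) := fun j =>
    integrable_of_continuousOn
      (((hφ j).contDiff.continuous_fderiv one_ne_zero).continuousOn.clm_apply
        (continuousOn_finsetSum _ fun i _ => (hA i j).smul (hX i).continuousOn))
      (hφ j).hasCompactSupport (hφ j).tsupport_subset
      fun x hx => by simp [fderiv_eq_zero_of_notMem_tsupport hx]
  have hzero : ∫ x in Ω, ∑ j, fderiv ℝ (fun y => ζ y * along (X j) w y) x
      (∑ i, linCoeff (hessian X z x) i j • X i x) = 0 := by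
    rw [integral_finsetSum _ fun j _ => (hi3 j).integrableOn]
    exact Finset.sum_eq_zero fun j _ =>
      integral_fderiv_linCoeff_column hΩ hX hanti hcomm hz j (hφ j)
  rw [eq_neg_iff_add_eq_zero, ← integral_add hi1.integrableOn hi2.integrableOn, ← hzero]
  refine setIntegral_congr_fun hΩ.measurableSet fun x hx => ?_
  have hprod : ∀ i j, fderiv ℝ (fun y => ζ y * along (X j) w y) x (X i x)
      = along (X i) ζ x * along (X j) w x + ζ x * hessian X w x i j := fun i j =>
    along_mul (hζ.contDiff.differentiable one_ne_zero x)
      (((hXw j).contDiffAt (hΩ.mem_nhds hx)).differentiableAt one_ne_zero)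
  simp only [map_sum, map_smul, smul_eq_mul, hprod]
  rw [Finset.sum_comm (s := Finset.univ) (t := Finset.univ)
    (f := fun j i => linCoeff (hessian X z x) i j * _)]
  simp only [Finset.mul_sum, ← Finset.sum_add_distrib]
  refine Finset.sum_congr rfl fun i _ => Finset.sum_congr rfl fun j _ => ?_
  ring

/-- Testing with a nondecreasing function `θ(w)` of `w` gives an inequality, since
`∑ᵢⱼ Aᵢⱼ Xᵢ(θ(w)) Xⱼ w = θ'(w) ∑ᵢⱼ F₂^{ij}(X²z) Xᵢ w Xⱼ w ≥ 0`. -/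
theorem integral_comp_mul_linCoeff_hessian_nonpos (hΩ : IsOpen Ω)
    {X : Fin m → EuclideanSpace ℝ (Fin n) → EuclideanSpace ℝ (Fin n)}
    (hX : ∀ i, ContDiffOn ℝ ∞ (X i) Ω) (hanti : ∀ i, AntiSelfAdjointOn (X i) Ω)
    (hcomm : SecondCommutatorsVanishOn X Ω) {z w : EuclideanSpace ℝ (Fin n) → ℝ}
    (hz : ContDiffOn ℝ 2 z Ω) (hw : ContDiffOn ℝ 2 w Ω) (hell : DegenerateEllipticOn X z Ω)
    {θ : ℝ → ℝ} (hθ : Differentiable ℝ θ) (hmono : Monotone θ)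
    {ζ : EuclideanSpace ℝ (Fin n) → ℝ} (hζ : IsTest 1 Ω ζ) (hζw : ∀ x ∈ Ω, ζ x = θ (w x)) :
    ∫ x in Ω, ζ x * ∑ i, ∑ j, linCoeff (hessian X z x) i j * hessian X w x i j ≤ 0 := by
  rw [integral_mul_linCoeff_hessian hΩ hX hanti hcomm hz hw hζ, neg_nonpos]
  refine setIntegral_nonneg hΩ.measurableSet fun x hx => ?_
  have hwd : DifferentiableAt ℝ w x :=
    (hw.contDiffAt (hΩ.mem_nhds hx)).differentiableAt two_ne_zero
  have hal : ∀ i, along (X i) ζ x = deriv θ (w x) * along (X i) w x := by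
    intro i
    have hd : fderiv ℝ (fun y => θ (w y)) x = _ :=
      ((hθ (w x)).hasDerivAt.comp_hasFDerivAt x hwd.hasFDerivAt).fderiv
    rw [along_congr hΩ hx hζw, along, hd]
    simp [along]
  have heq : ∑ i, ∑ j, linCoeff (hessian X z x) i j * along (X i) ζ x * along (X j) w x
      = deriv θ (w x) * ∑ i, ∑ j,
        linCoeff (hessian X z x) i j * along (X i) w x * along (X j) w x := by
    simp only [hal, Finset.mul_sum]
    exact Finset.sum_congr rfl fun i _ => Finset.sum_congr rfl fun j _ => by ring
  rw [heq, sum_linCoeff_mul_mul]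
  exact mul_nonneg hmono.deriv_nonneg (hell x hx _)

/-! ### Derivatives on zero sets -/

/-- The derivative of a `C¹` function along an anti-self-adjoint field vanishes almost everywhere
on the zero set of the function. -/
theorem AntiSelfAdjointOn.ae_along_eq_zero (hΩ : IsOpen Ω)
    {V : EuclideanSpace ℝ (Fin n) → EuclideanSpace ℝ (Fin n)} (hVc : ContinuousOn V Ω)
    (hV : AntiSelfAdjointOn V Ω) {g : EuclideanSpace ℝ (Fin n) → ℝ} (hg : ContDiffOn ℝ 1 g Ω) :
    ∀ᵐ x, x ∈ Ω → g x = 0 → along V g x = 0 := by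
  have hgV : ContinuousOn (along V g) Ω :=
    (hg.continuousOn_fderiv_of_isOpen hΩ le_rfl).clm_apply hVc
  set Z := Ω ∩ g ⁻¹' {0} with hZ
  have hZm : MeasurableSet Z := by
    obtain ⟨F, hF, hFe⟩ := continuousOn_iff_isClosed.1 hg.continuousOn {0} isClosed_singleton
    rw [hZ, Set.inter_comm, hFe]
    exact hF.measurableSet.inter hΩ.measurableSet
  have hloc : LocallyIntegrableOn (Z.indicator (along V g)) Ω := by
    rw [locallyIntegrableOn_iff hΩ.isLocallyClosed]
    exact fun K hKΩ hK => ((hgV.mono hKΩ).integrableOn_compact hK).indicator hZm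
  have hae := hΩ.ae_eq_zero_of_integral_contDiff_smul_eq_zero hloc ?_
  · filter_upwards [hae] with x hx hxΩ hgx
    simpa [hZ, hxΩ, hgx] using hx hxΩ
  intro χ hχ hχc hχΩ
  have hχ1 : IsTest 1 Ω χ := IsTest.of_le ⟨hχ, hχc, hχΩ⟩ (by exact_mod_cast le_top)
  have hχi : Integrable fun x => along V g x * χ x :=
    integrable_of_continuousOn (hgV.mul hχ.continuous.continuousOn) hχc hχΩ
      fun x hx => by simp [image_eq_zero_of_notMem_tsupport hx]
  have hVχi : Integrable (along V χ) :=
    integrable_of_continuousOn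
      ((hχ1.contDiff.continuous_fderiv one_ne_zero).continuousOn.clm_apply hVc) hχc hχΩ
      fun x hx => by simp [along, fderiv_eq_zero_of_notMem_tsupport hx]
  -- `arctan (k g) / k` tends to `0` uniformly, while its derivative along `V`, which is
  -- `V g / (1 + (k g)²)`, tends boundedly to `V g` on `{g = 0}` and to `0` elsewhere.
  have hparts : ∀ c : ℝ, 0 < c → ∫ x in Ω, 1 / (1 + (c * g x) ^ 2) * (along V g x * χ x)
      = - ∫ x in Ω, 1 / c * (Real.arctan (c * g x) * along V χ x) := by
    intro c hc
    have hf : ContDiffOn ℝ 1 (fun x => 1 / c * Real.arctan (c * g x)) Ω :=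
      contDiffOn_const.mul (Real.contDiff_arctan.comp_contDiffOn (contDiffOn_const.mul hg))
    have h := hV.integral_along_mul hΩ hVc hf hχ1
    simp only [mul_assoc] at h ⊢
    rw [← h]
    refine setIntegral_congr_fun hΩ.measurableSet fun x hx => ?_
    have hgx := ((hg.contDiffAt (hΩ.mem_nhds hx)).differentiableAt one_ne_zero).hasFDerivAt
    have hd := ((hgx.const_mul c).arctan.const_mul (1 / c)).fderiv
    rw [along.eq_1 _ (fun x => 1 / c * Real.arctan (c * g x)), hd]
    simp only [smul_apply, smul_eq_mul, along]
    field_simp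
  have hk : ∀ k : ℕ, 0 < (k : ℝ) + 1 := fun k => by positivity
  have hlim1 : Filter.Tendsto
      (fun k : ℕ => ∫ x in Ω, 1 / (1 + (((k : ℝ) + 1) * g x) ^ 2) * (along V g x * χ x))
      Filter.atTop (nhds (∫ x in Ω, χ x • Z.indicator (along V g) x)) := by
    refine tendsto_integral_of_dominated_convergence (fun x => ‖along V g x * χ x‖)
      (fun k => ?_) hχi.integrableOn.norm (fun k => .of_forall fun x => ?_) ?_
    · refine ContinuousOn.aestronglyMeasurable ?_ hΩ.measurableSet
      refine ContinuousOn.mul ?_ (hgV.mul hχ.continuous.continuousOn)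
      exact continuousOn_const.div
        (continuousOn_const.add ((continuousOn_const.mul hg.continuousOn).pow 2))
        fun x _ => by positivity
    · rw [norm_mul]
      refine mul_le_of_le_one_left (norm_nonneg _) ?_
      rw [Real.norm_of_nonneg (by positivity)]
      exact div_le_one_of_le₀ (by nlinarith [sq_nonneg (((k : ℝ) + 1) * g x)]) (by positivity)
    · refine (ae_restrict_mem hΩ.measurableSet).mono fun x hx => ?_
      by_cases hgx : g x = 0
      · have : x ∈ Z := ⟨hx, hgx⟩
        simp [hgx, this, mul_comm]
      · have : x ∉ Z := fun h => hgx h.2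
        rw [Set.indicator_of_notMem this, smul_zero]
        have hinf : Filter.Tendsto (fun k : ℕ => 1 + (((k : ℝ) + 1) * g x) ^ 2) Filter.atTop
            Filter.atTop := by
          simp only [mul_pow]
          refine Filter.tendsto_atTop_add_const_left _ _ (Filter.Tendsto.atTop_mul_const
            (by positivity) ((Filter.tendsto_pow_atTop two_ne_zero).comp
              (Filter.tendsto_atTop_add_const_right _ _ tendsto_natCast_atTop_atTop)))
        simpa using (hinf.inv_tendsto_atTop).mul_const (along V g x * χ x)
  have hlim2 : Filter.Tendsto
      (fun k : ℕ => - ∫ x in Ω, 1 / ((k : ℝ) + 1) *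
        (Real.arctan (((k : ℝ) + 1) * g x) * along V χ x)) Filter.atTop (nhds 0) := by
    have hb : Filter.Tendsto (fun k : ℕ => 1 / ((k : ℝ) + 1) *
        ∫ x in Ω, Real.pi / 2 * ‖along V χ x‖) Filter.atTop (nhds 0) := by
      simpa using tendsto_one_div_add_atTop_nhds_zero_nat.mul_const
        (∫ x in Ω, Real.pi / 2 * ‖along V χ x‖)
    refine squeeze_zero_norm (fun k => ?_) hb
    rw [norm_neg, integral_const_mul, norm_mul, Real.norm_of_nonneg (by positivity)]
    refine mul_le_mul_of_nonneg_left ?_ (by positivity)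
    refine norm_integral_le_of_norm_le (hVχi.norm.const_mul _).integrableOn
      (.of_forall fun x => ?_)
    rw [norm_mul]
    refine mul_le_mul_of_nonneg_right ?_ (norm_nonneg _)
    rw [Real.norm_eq_abs, abs_le]
    exact ⟨by linarith [Real.neg_pi_div_two_lt_arctan (((k : ℝ) + 1) * g x)],
      (Real.arctan_lt_pi_div_two _).le⟩
  rw [← setIntegral_eq_integral_of_forall_compl_eq_zero (s := Ω) fun x hx => by
    simp [image_eq_zero_of_notMem_tsupport fun h => hx (hχΩ h)]]
  exact tendsto_nhds_unique hlim1 (hlim2.congr fun k => (hparts _ (hk k)).symm)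

/-- If `w ≥ 0` then `X²w = 0` almost everywhere on `{w = 0}`: all `Xⱼ w` vanish there, because `w`
attains its minimum, hence so do almost everywhere their derivatives. -/
theorem ae_hessian_eq_zero (hΩ : IsOpen Ω)
    {X : Fin m → EuclideanSpace ℝ (Fin n) → EuclideanSpace ℝ (Fin n)}
    (hX : ∀ i, ContDiffOn ℝ ∞ (X i) Ω) (hanti : ∀ i, AntiSelfAdjointOn (X i) Ω)
    {w : EuclideanSpace ℝ (Fin n) → ℝ} (hw : ContDiffOn ℝ 2 w Ω) (hw0 : ∀ x ∈ Ω, 0 ≤ w x) :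
    ∀ᵐ x, x ∈ Ω → w x = 0 → hessian X w x = 0 := by
  have h : ∀ i j, ∀ᵐ x, x ∈ Ω → along (X j) w x = 0 → along (X i) (along (X j) w) x = 0 :=
    fun i j => (hanti i).ae_along_eq_zero hΩ (hX i).continuousOn
      (contDiffOn_along hΩ (hX j) hw (by norm_num) (by exact_mod_cast le_top))
  filter_upwards [ae_all_iff.2 fun i => ae_all_iff.2 (h i)] with x hx hxΩ hwx
  have hmin : IsLocalMin w x := by
    filter_upwards [hΩ.mem_nhds hxΩ] with y hy
    rw [hwx]
    exact hw0 y hy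
  ext i j
  exact hx i j hxΩ (by simp [along, hmin.fderiv_eq_zero])

/-! ### Extended integrals and the comparison -/

theorem lintegral_ofReal_le_lintegral_ofReal_neg_iff {α : Type*} [MeasurableSpace α]
    {μ : Measure α} {f : α → ℝ} (hf : Integrable f μ) :
    ∫⁻ x, ENNReal.ofReal (f x) ∂μ ≤ ∫⁻ x, ENNReal.ofReal (-f x) ∂μ ↔ ∫ x, f x ∂μ ≤ 0 := by
  rw [integral_eq_lintegral_pos_part_sub_lintegral_neg_part hf, sub_nonpos]
  exact (ENNReal.toReal_le_toReal hf.lintegral_lt_top.ne hf.neg.lintegral_lt_top.ne).symm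

/-- If the positive part of `g - f` has at most the integral of the negative part, then
`∫ g ≤ ∫ f` whenever both sides exist. -/
theorem extIntegral_le_extIntegral {f g : EuclideanSpace ℝ (Fin n) → ℝ}
    (hf : AEMeasurable f (volume.restrict Ω)) (hg : AEMeasurable g (volume.restrict Ω))
    (hfi : HasExtIntegral Ω f) (hgi : HasExtIntegral Ω g)
    (h : ∫⁻ x in Ω, ENNReal.ofReal (g x - f x) ≤ ∫⁻ x in Ω, ENNReal.ofReal (f x - g x)) :
    extIntegral Ω g ≤ extIntegral Ω f := by
  -- `∫ g⁺ + ∫ f⁻ + ∫ (f - g)⁺ = ∫ f⁺ + ∫ g⁻ + ∫ (g - f)⁺`, free of subtraction in `[0, ∞]`.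
  have hkey : (∫⁻ x in Ω, ENNReal.ofReal (g x)) + (∫⁻ x in Ω, ENNReal.ofReal (-f x))
      + (∫⁻ x in Ω, ENNReal.ofReal (f x - g x))
      = (∫⁻ x in Ω, ENNReal.ofReal (f x)) + (∫⁻ x in Ω, ENNReal.ofReal (-g x))
      + (∫⁻ x in Ω, ENNReal.ofReal (g x - f x)) := by
    rw [← lintegral_add_left' hg.ennreal_ofReal, ← lintegral_add_left' hf.ennreal_ofReal,
      ← lintegral_add_right' (fun x => _ + _) (hf.fun_sub hg).ennreal_ofReal,
      ← lintegral_add_right' (fun x => _ + _) (hg.fun_sub hf).ennreal_ofReal]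
    refine lintegral_congr fun x => ?_
    simp only [ENNReal.ofReal]
    norm_cast
    ext
    push_cast
    simp only [Real.coe_toNNReal']
    grind
  have hle : (∫⁻ x in Ω, ENNReal.ofReal (f x - g x))
      ≤ (∫⁻ x in Ω, ENNReal.ofReal (f x)) + (∫⁻ x in Ω, ENNReal.ofReal (-g x)) := by
    rw [← lintegral_add_left' hf.ennreal_ofReal]
    refine lintegral_mono fun x => ?_
    rw [sub_eq_add_neg]
    exact ENNReal.ofReal_add_le
  unfold extIntegral
  unfold HasExtIntegral at hfi hgi
  generalize (∫⁻ x in Ω, ENNReal.ofReal (g x)) = a at *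
  generalize (∫⁻ x in Ω, ENNReal.ofReal (-g x)) = b at *
  generalize (∫⁻ x in Ω, ENNReal.ofReal (f x)) = c at *
  generalize (∫⁻ x in Ω, ENNReal.ofReal (-f x)) = d at *
  generalize (∫⁻ x in Ω, ENNReal.ofReal (f x - g x)) = p at *
  generalize (∫⁻ x in Ω, ENNReal.ofReal (g x - f x)) = q at *
  -- If `∫ f⁺ = ∞` or `∫ g⁻ = ∞` then the claim is trivial, and otherwise all integrals are finite.
  by_cases hc : c = ⊤
  · have hd : d ≠ ⊤ := hfi.resolve_left (not_not.2 hc)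
    lift d to NNReal using hd
    subst hc
    simp
  by_cases hb : b = ⊤
  · subst hb
    simp
  have hp : p ≠ ⊤ := (hle.trans_lt (ENNReal.add_lt_top.2 ⟨Ne.lt_top hc, Ne.lt_top hb⟩)).ne
  have hq : q ≠ ⊤ := (h.trans_lt hp.lt_top).ne
  have had : a + d + p ≠ ⊤ := by simp [hkey, hc, hb, hq]
  obtain ⟨ha, hd⟩ := ENNReal.add_ne_top.1 (ENNReal.add_ne_top.1 had).1
  lift a to NNReal using ha
  lift b to NNReal using hb
  lift c to NNReal using hc
  lift d to NNReal using hd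
  lift p to NNReal using hp
  lift q to NNReal using hq
  norm_cast at hkey h
  have hkey' := congrArg (fun t : NNReal => (t : ℝ)) hkey
  push_cast at hkey'
  have hqp : (q : ℝ) ≤ p := h
  simp only [EReal.coe_nnreal_eq_coe_real]
  norm_cast
  linarith

/-- The comparison without integrability assumption: the inequality tested with a nondecreasing
function of `w = v - u` passes to the limit by monotone convergence in its positive part. -/
theorem lintegral_opF2_sub_le (hΩ : IsOpen Ω) (hΩb : Bornology.IsBounded Ω)
    {X : Fin m → EuclideanSpace ℝ (Fin n) → EuclideanSpace ℝ (Fin n)}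
    (hX : ∀ i, ContDiffOn ℝ ∞ (X i) Ω) (hanti : ∀ i, AntiSelfAdjointOn (X i) Ω)
    (hcomm : SecondCommutatorsVanishOn X Ω) {u v : EuclideanSpace ℝ (Fin n) → ℝ}
    (hu : ContDiffOn ℝ 2 u Ω) (huc : ContinuousOn u (closure Ω))
    (hv : ContDiffOn ℝ 2 v Ω) (hvc : ContinuousOn v (closure Ω))
    (huv : ∀ x ∈ Ω, u x ≤ v x) (hbd : ∀ x ∈ frontier Ω, u x = v x)
    (hell : DegenerateEllipticOn X (fun x => u x + v x) Ω) :
    ∫⁻ x in Ω, ENNReal.ofReal (opF2 X v x - opF2 X u x)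
      ≤ ∫⁻ x in Ω, ENNReal.ofReal (opF2 X u x - opF2 X v x) := by
  -- The form `v + -u` of `v - u` fits `hessian_add` and `hessian_neg`.
  set w : EuclideanSpace ℝ (Fin n) → ℝ := fun x => v x + -u x with hw_def
  have hw : ContDiffOn ℝ 2 w Ω := hv.add hu.neg
  have hw0 : ∀ x ∈ Ω, 0 ≤ w x := fun x hx => by have := huv x hx; simp only [hw_def]; linarith
  have hwc : ContinuousOn w (closure Ω) := hvc.add huc.neg
  have hwb : ∀ x ∈ frontier Ω, w x = 0 := fun x hx => by simp [hw_def, hbd x hx]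
  have hz : ContDiffOn ℝ 2 (fun x => u x + v x) Ω := hu.add hv
  set D : EuclideanSpace ℝ (Fin n) → ℝ := fun x => opF2 X v x - opF2 X u x with hD
  have hDc : ContinuousOn D Ω := (continuousOn_opF2 hΩ hX hv).sub (continuousOn_opF2 hΩ hX hu)
  have hDm : AEMeasurable D (volume.restrict Ω) := hDc.aemeasurable hΩ.measurableSet
  have hDeq : ∀ x ∈ Ω, D x = 1 / 2 * ∑ i, ∑ j,
      linCoeff (hessian X (fun x => u x + v x) x) i j * hessian X w x i j := by
    intro x hx
    rw [hD, hw_def, hessian_add hΩ hX hu hv hx, hessian_add hΩ hX hv hu.neg hx, hessian_neg,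
      ← sub_eq_add_neg, ← scrF2_sub_scrF2]
    rfl
  have hD0 : ∀ᵐ x ∂(volume.restrict Ω), w x = 0 → D x = 0 := by
    rw [ae_restrict_iff' hΩ.measurableSet]
    filter_upwards [ae_hessian_eq_zero hΩ hX hanti hw hw0] with x hx hxΩ hwx
    simp [hDeq x hxΩ, hx hxΩ hwx]
  -- As `w ≥ 0` on `Ω`, these test functions increase with `k` to the indicator of `{w > 0}`.
  set ζ : ℕ → EuclideanSpace ℝ (Fin n) → ℝ :=
    fun k => Ω.indicator fun x => Real.smoothTransition (k * w x - 1) with hζ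
  have hζt : ∀ k, IsTest 1 Ω (ζ k) := fun k =>
    (isTest_indicator_smoothTransition (k := 2) hΩ hΩb hw hwc hwb k).of_le (by norm_num)
  have hζw : ∀ k, ∀ x ∈ Ω, ζ k x = Real.smoothTransition (k * w x - 1) :=
    fun k x hx => Set.indicator_of_mem hx _
  have hint : ∀ k, ∫ x in Ω, ζ k x * D x ≤ 0 := by
    intro k
    have h := integral_comp_mul_linCoeff_hessian_nonpos hΩ hX hanti hcomm hz hw hell
      (θ := fun t => Real.smoothTransition (k * t - 1))
      ((Real.smoothTransition.contDiff (n := 1)).differentiable one_ne_zero |>.comp (by fun_prop))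
      (fun s t hst => Real.smoothTransition.monotone (by gcongr)) (hζt k) (hζw k)
    have : ∫ x in Ω, ζ k x * D x = 1 / 2 * ∫ x in Ω, ζ k x * ∑ i, ∑ j,
        linCoeff (hessian X (fun x => u x + v x) x) i j * hessian X w x i j := by
      rw [← integral_const_mul]
      refine setIntegral_congr_fun hΩ.measurableSet fun x hx => ?_
      simp only [hDeq x hx]
      ring
    rw [this]
    linarith
  have hbound : ∀ k, ∫⁻ x in Ω, ENNReal.ofReal (ζ k x * D x)
      ≤ ∫⁻ x in Ω, ENNReal.ofReal (opF2 X u x - opF2 X v x) := by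
    intro k
    have hi : Integrable fun x => ζ k x * D x :=
      integrable_of_continuousOn ((hζt k).contDiff.continuous.continuousOn.mul hDc)
        (hζt k).hasCompactSupport (hζt k).tsupport_subset
        fun x hx => by simp [image_eq_zero_of_notMem_tsupport hx]
    refine ((lintegral_ofReal_le_lintegral_ofReal_neg_iff hi.integrableOn).2 (hint k)).trans ?_
    refine setLIntegral_mono' hΩ.measurableSet fun x hx => ENNReal.ofReal_le_ofReal_iff'.2 ?_
    rw [hζw k x hx]
    have h0 := Real.smoothTransition.nonneg (k * w x - 1)
    have h1 := Real.smoothTransition.le_one (k * w x - 1)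
    have hDx : opF2 X u x - opF2 X v x = -D x := by simp [hD]
    rw [hDx]
    by_cases hs : D x ≤ 0
    · left; nlinarith
    · right; nlinarith
  refine le_of_tendsto' (lintegral_tendsto_of_tendsto_of_monotone
    (f := fun k x => ENNReal.ofReal (ζ k x * D x)) (fun k => ?_) ?_ ?_) hbound
  · exact (((hζt k).contDiff.continuous.aemeasurable).mul hDm).ennreal_ofReal
  · refine (ae_restrict_mem hΩ.measurableSet).mono fun x hx k l hkl => ?_
    by_cases hs : 0 ≤ D x
    · refine ENNReal.ofReal_le_ofReal (mul_le_mul_of_nonneg_right ?_ hs)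
      rw [hζw k x hx, hζw l x hx]
      refine Real.smoothTransition.monotone ?_
      have := mul_le_mul_of_nonneg_right (Nat.cast_le (α := ℝ).2 hkl) (hw0 x hx)
      linarith
    · have : ζ k x * D x ≤ 0 := mul_nonpos_of_nonneg_of_nonpos
        (by rw [hζw k x hx]; exact Real.smoothTransition.nonneg _) (le_of_not_ge hs)
      simp [ENNReal.ofReal_of_nonpos this]
  · filter_upwards [ae_restrict_mem hΩ.measurableSet, hD0] with x hx hDx
    by_cases hwx : w x = 0
    · change Filter.Tendsto _ _ (nhds (ENNReal.ofReal (D x)))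
      simp [hDx hwx]
    have hpos : 0 < w x := lt_of_le_of_ne (hw0 x hx) (Ne.symm hwx)
    refine tendsto_const_nhds.congr' ?_
    filter_upwards [Filter.eventually_ge_atTop ⌈2 / w x⌉₊] with k hk
    have : 2 ≤ k * w x := (div_le_iff₀ hpos).1 (Nat.ceil_le.1 hk)
    rw [hζw k x hx, Real.smoothTransition.one_of_one_le (by linarith), one_mul]

end

end Subelliptic

end

theorem lemma2p1 {n m : ℕ} (Ω : Set (EuclideanSpace ℝ (Fin n)))
    (hΩ : IsOpen Ω) (hΩb : Bornology.IsBounded Ω)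
    (X : Fin m → EuclideanSpace ℝ (Fin n) → EuclideanSpace ℝ (Fin n))
    (hX : ∀ i, ContDiffOn ℝ ∞ (X i) Ω)
    (hX_anti : ∀ i, Subelliptic.AntiSelfAdjointOn (X i) Ω)
    (hX_comm : Subelliptic.SecondCommutatorsVanishOn X Ω)
    (u v : EuclideanSpace ℝ (Fin n) → ℝ)
    (hu : ContDiffOn ℝ 2 u Ω) (huc : ContinuousOn u (closure Ω))
    (hv : ContDiffOn ℝ 2 v Ω) (hvc : ContinuousOn v (closure Ω))
    (huv : ∀ x ∈ Ω, u x ≤ v x)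
    (hbd : ∀ x ∈ frontier Ω, u x = v x)
    (hell : Subelliptic.DegenerateEllipticOn X (fun x => u x + v x) Ω) :
    -- the inequality between the integrals, whenever both exist in `[-∞, ∞]`
    (Subelliptic.HasExtIntegral Ω (Subelliptic.opF2 X u) →
      Subelliptic.HasExtIntegral Ω (Subelliptic.opF2 X v) →
      Subelliptic.extIntegral Ω (Subelliptic.opF2 X v)
        ≤ Subelliptic.extIntegral Ω (Subelliptic.opF2 X u)) ∧
    -- the same inequality for real integrals, when both integrands are integrable
    (IntegrableOn (Subelliptic.opF2 X u) Ω → IntegrableOn (Subelliptic.opF2 X v) Ω →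
      ∫ x in Ω, Subelliptic.opF2 X v x ≤ ∫ x in Ω, Subelliptic.opF2 X u x) ∧
    -- the inequality for the difference of the integrands, without any integrability
    ∫⁻ x in Ω, ENNReal.ofReal (Subelliptic.opF2 X v x - Subelliptic.opF2 X u x)
      ≤ ∫⁻ x in Ω, ENNReal.ofReal (Subelliptic.opF2 X u x - Subelliptic.opF2 X v x) := by
  have key :=
    Subelliptic.lintegral_opF2_sub_le hΩ hΩb hX hX_anti hX_comm hu huc hv hvc huv hbd hell
  refine ⟨fun hui hvi => Subelliptic.extIntegral_le_extIntegral
    ((Subelliptic.continuousOn_opF2 hΩ hX hu).aemeasurable hΩ.measurableSet)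
    ((Subelliptic.continuousOn_opF2 hΩ hX hv).aemeasurable hΩ.measurableSet) hui hvi key,
    fun hui hvi => ?_, key⟩
  have h := Subelliptic.lintegral_ofReal_le_lintegral_ofReal_neg_iff (hvi.sub hui)
  simp only [Pi.sub_apply, neg_sub] at h
  rw [← sub_nonpos, ← integral_sub hvi hui]
  exact h.1 key
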